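/- Setting. Let $T>0$, let $\mathbb A\subset\mathbb R^{m_a}$ and $\mathbb B\subset\mathbb R^{m_b}$ be nonempty compact sets, and let $f:[0,T]\times\mathbb R^n\times\mathbb A\times\mathbb B\to\mathbb R^n$ be bounded, uniformly continuous, and Lipschitz in the state $x$ uniformly in the other variables. Let $c_1,c_2,g:[0,T]\times\mathbb R^n\to\mathbb R$ be Lipschitz continuous (for example, signed distance functions to the space--time hard-constraint, soft-constraint and target sets). For $t\in[0,T]$ let $\mathcal A_t$, $\mathcal B_t$ be the sets of measurable functions from $[t,T]$ to $\mathbb A$, $\mathbb B$, and let $\Delta_t$ be the set of non-anticipative strategies, i.e. of maps $\delta:\mathcal A_t\to\mathcal B_t$ such that for all $s\in[t,T]$ and $\bm a,\bar{\bm a}\in\mathcal A_t$, if $\bm a=\bar{\bm a}$ a.e. on $[t,s]$ then $\delta[\bm a]=\delta[\bar{\bm a}]$ a.e. on $[t,s]$. For $\epsilon>0$ put $h_\epsilon(s,x)=\min\bigl(1,\max(0,\tfrac1\epsilon c_2(s,x))\bigr)$. For $\bm a\in\mathcal A_t$, $\bm b\in\mathcal B_t$ and $(x,z)\in\mathbb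 R^n\times\mathbb R$, let $(\phi,\xi)=(\phi^{\bm a,\bm b}_{t,x},\xi^{\bm a,\bm b}_{t,x,z}):[t,T]\to\mathbb R^n\times\mathbb R$ be the unique absolutely continuous function with $\phi(t)=x$, $\xi(t)=z$ and $$\dot\phi(s)=f(s,\phi(s),\bm a(s),\bm b(s)),\qquad \dot\xi(s)=-h_\epsilon(s,\phi(s))\qquad\text{for a.e. }s\in[t,T].$$ Define $$W_\epsilon(t,x,z)=\sup_{\delta\in\Delta_t}\inf_{\bm a\in\mathcal A_t}\min_{\tau\in[t,T]}\max\Bigl\{\max_{s\in[t,\tau]}c_1\bigl(s,\phi^{\bm a,\delta[\bm a]}_{t,x}(s)\bigr),\,c_2\bigl(\tau,\phi^{\bm a,\delta[\bm a]}_{t,x}(\tau)\bigr),\,-\xi^{\bm a,\delta[\bm a]}_{t,x,z}(\tau),\,g\bigl(\tau,\phi^{\bm a,\delta[\bm a]}_{t,x}(\tau)\bigr)\Bigr\}.$$ Proposition. Let $\epsilon>0$. Then $W_\epsilon$ is real-valued on $[0,T]\times\mathbb R^n\times\mathbb R$ and, for every $t\in[0,T)$ and $\tilde\delta>0$ with $t+\tilde\delta\le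 T$, and for all $(x,z)\in\mathbb R^n\times\mathbb R$, $$\begin{aligned}W_\epsilon(t,x,z)=\sup_{\delta\in\Delta_t}\inf_{\bm a\in\mathcal A_t}\min\Bigl[&\min_{\tau\in[t,t+\tilde\delta]}\max\Bigl(\max_{s\in[t,\tau]}c_1\bigl(s,\phi^{\bm a,\delta[\bm a]}_{t,x}(s)\bigr),\,c_2\bigl(\tau,\phi^{\bm a,\delta[\bm a]}_{t,x}(\tau)\bigr),\,-\xi^{\bm a,\delta[\bm a]}_{t,x,z}(\tau),\,g\bigl(\tau,\phi^{\bm a,\delta[\bm a]}_{t,x}(\tau)\bigr)\Bigr),\\&\max\Bigl(\max_{\tau\in[t,t+\tilde\delta]}c_1\bigl(\tau,\phi^{\bm a,\delta[\bm a]}_{t,x}(\tau)\bigr),\,W_\epsilon\bigl(t+\tilde\delta,\phi^{\bm a,\delta[\bm a]}_{t,x}(t+\tilde\delta),\xi^{\bm a,\delta[\bm a]}_{t,x,z}(t+\tilde\delta)\bigr)\Bigr)\Bigr].\end{aligned}$$ -/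

import Mathlib

open Set MeasureTheory
open scoped NNReal

noncomputable section

namespace SoftReachAvoid

/-- The state space `ℝⁿ` with its Euclidean norm. -/
abbrev Vec (n : ℕ) : Type := EuclideanSpace ℝ (Fin n)

/-- The data of the game: the horizon `T`, the dynamics `f`, the control sets `A`, `B` of the two
players, the functions `c₁`, `c₂` describing the hard and the soft constraint and the function
`g` describing the target. Only values at times in `[0, T]` and controls in `A`, `B` matter. -/
structure Game (n p q : ℕ) where
  T : ℝ
  f : ℝ → Vec n → Vec p → Vec q → Vec n
  A : Set (Vec p)
  B : Set (Vec q)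
  c₁ : ℝ → Vec n → ℝ
  c₂ : ℝ → Vec n → ℝ
  g : ℝ → Vec n → ℝ

/-- `c` is Lipschitz continuous on `[0, T] × ℝⁿ`, jointly in time and state. -/
def LipschitzTimeState {n : ℕ} (T : ℝ) (c : ℝ → Vec n → ℝ) : Prop :=
  ∃ L : ℝ≥0, LipschitzOnWith L (fun r : ℝ × Vec n => c r.1 r.2) (Icc 0 T ×ˢ univ)

/-- The standing assumptions: `A` and `B` are nonempty and compact; `f` is bounded and uniformly
continuous on `[0, T] × ℝⁿ × A × B` and Lipschitz in the state, uniformly in the other variables;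
`c₁`, `c₂`, `g` are Lipschitz on `[0, T] × ℝⁿ`. -/
structure Game.Standing {n p q : ℕ} (G : Game n p q) : Prop where
  A_nonempty : G.A.Nonempty
  A_compact : IsCompact G.A
  B_nonempty : G.B.Nonempty
  B_compact : IsCompact G.B
  f_bounded : ∃ M : ℝ, ∀ s ∈ Icc 0 G.T, ∀ x, ∀ a ∈ G.A, ∀ b ∈ G.B, ‖G.f s x a b‖ ≤ M
  f_uniformContinuous :
    UniformContinuousOn (fun r : ℝ × Vec n × Vec p × Vec q => G.f r.1 r.2.1 r.2.2.1 r.2.2.2)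
      (Icc 0 G.T ×ˢ univ ×ˢ G.A ×ˢ G.B)
  f_lipschitz : ∃ L : ℝ≥0, ∀ s ∈ Icc 0 G.T, ∀ a ∈ G.A, ∀ b ∈ G.B,
    LipschitzWith L (fun x => G.f s x a b)
  c₁_lipschitz : LipschitzTimeState G.T G.c₁
  c₂_lipschitz : LipschitzTimeState G.T G.c₂
  g_lipschitz : LipschitzTimeState G.T G.g

/-- The (Lebesgue) measurable functions from `[t, T]` to `U`. They are represented by functions on
`ℝ`, whose values outside `[t, T]` are irrelevant. -/
def Controls {m : ℕ} (t T : ℝ) (U : Set (Vec m)) : Type :=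
  {u : ℝ → Vec m // AEMeasurable u (volume.restrict (Icc t T)) ∧ ∀ s ∈ Icc t T, u s ∈ U}

/-- Two functions of time coincide almost everywhere on `[t, s]`. -/
def AgreeOn {m : ℕ} (t s : ℝ) (u v : ℝ → Vec m) : Prop :=
  u =ᵐ[volume.restrict (Icc t s)] v

namespace Game

variable {n p q : ℕ}

/-- The controls `𝒜ₜ` of Player A. -/
abbrev ControlsA (G : Game n p q) (t : ℝ) : Type := Controls t G.T G.A

/-- The controls `ℬₜ` of Player B. -/
abbrev ControlsB (G : Game n p q) (t : ℝ) : Type := Controls t G.T G.B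

/-- The non-anticipative strategies `Δₜ` of Player B. -/
def Strategies (G : Game n p q) (t : ℝ) : Type :=
  {δ : G.ControlsA t → G.ControlsB t //
    ∀ s ∈ Icc t G.T, ∀ a a' : G.ControlsA t,
      AgreeOn t s a.1 a'.1 → AgreeOn t s (δ a).1 (δ a').1}

/-- The regularization `h_ε(s, x) = min(1, max(0, c₂(s, x) / ε))` of the indicator function of
violation of the soft constraint. -/
def h (G : Game n p q) (ε s : ℝ) (x : Vec n) : ℝ :=
  min 1 (max 0 (1 / ε * G.c₂ s x))

/-- The regularized augmented dynamics on `ℝⁿ × ℝ`. -/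
def augF (G : Game n p q) (ε s : ℝ) (y : Vec n × ℝ) (a : Vec p) (b : Vec q) : Vec n × ℝ :=
  (G.f s y.1 a b, -G.h ε s y.1)

/-- `y` is an absolutely continuous solution on `[t, T]` of the regularized augmented equation
with controls `a`, `b`, starting at `(x, z)` at time `t`; the equation holds almost everywhere. -/
def IsTrajectory (G : Game n p q) (ε t : ℝ) (x : Vec n) (z : ℝ)
    (a : ℝ → Vec p) (b : ℝ → Vec q) (y : ℝ → Vec n × ℝ) : Prop :=
  AbsolutelyContinuousOnInterval y t G.T ∧ y t = (x, z) ∧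
    ∀ᵐ s ∂volume.restrict (Icc t G.T), HasDerivAt y (G.augF ε s (y s) (a s) (b s)) s

/-- The trajectory of the regularized augmented system. Under the standing assumptions a
trajectory exists and is unique on `[t, T]`; values outside `[t, T]` are not used. -/
def traj (G : Game n p q) (ε t : ℝ) (x : Vec n) (z : ℝ)
    (a : ℝ → Vec p) (b : ℝ → Vec q) : ℝ → Vec n × ℝ :=
  Classical.epsilon (G.IsTrajectory ε t x z a b)

/-- The state component `φ` of the trajectory. -/
def φ (G : Game n p q) (ε t : ℝ) (x : Vec n) (z : ℝ)
    (a : ℝ → Vec p) (b : ℝ → Vec q) (s : ℝ) : Vec n :=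
  (G.traj ε t x z a b s).1

/-- The budget component `ξ` of the trajectory. -/
def ξ (G : Game n p q) (ε t : ℝ) (x : Vec n) (z : ℝ)
    (a : ℝ → Vec p) (b : ℝ → Vec q) (s : ℝ) : ℝ :=
  (G.traj ε t x z a b s).2

/-- The running maximum `max_{s ∈ [t, τ]} c₁(s, φ(s))`. -/
def runningC₁ (G : Game n p q) (ε t : ℝ) (x : Vec n) (z : ℝ)
    (a : ℝ → Vec p) (b : ℝ → Vec q) (τ : ℝ) : EReal :=
  ⨆ s ∈ Icc t τ, (G.c₁ s (G.φ ε t x z a b s) : EReal)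

/-- The reach-avoid payoff attained within `[t, t']`:
`min_{τ ∈ [t, t']} max(max_{s ∈ [t, τ]} c₁(s, φ(s)), c₂(τ, φ(τ)), -ξ(τ), g(τ, φ(τ)))`.
Minima, maxima, suprema and infima are taken in the extended reals, a complete lattice. -/
def payoff (G : Game n p q) (ε t : ℝ) (x : Vec n) (z : ℝ)
    (a : ℝ → Vec p) (b : ℝ → Vec q) (t' : ℝ) : EReal :=
  ⨅ τ ∈ Icc t t',
    max (G.runningC₁ ε t x z a b τ)
      (max (G.c₂ τ (G.φ ε t x z a b τ) : EReal)
        (max ((-G.ξ ε t x z a b τ : ℝ) : EReal) (G.g τ (G.φ ε t x z a b τ) : EReal)))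

/-- The regularized soft-constrained value function
`W_ε(t, x, z) = sup_{δ ∈ Δₜ} inf_{a ∈ 𝒜ₜ}` of the reach-avoid payoff within `[t, T]`. -/
def W (G : Game n p q) (ε t : ℝ) (x : Vec n) (z : ℝ) : EReal :=
  ⨆ δ : G.Strategies t, ⨅ a : G.ControlsA t, G.payoff ε t x z a.1 (δ.1 a).1 G.T

end Game

end SoftReachAvoid

end

/-! Dynamic programming rests on three facts.

Cutting and pasting: controls can be glued at `r = t + d`, and non-anticipativity survives both
gluing strategies and passing to the continuation of a strategy after a fixed past
(`Strategies.glue`, `Strategies.continuation`).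

Flow property: the augmented equation is Lipschitz in the state, so a trajectory restarted at time
`r` from the point reached is the old trajectory (`IsTrajectory.eqOn`). Splitting the minimum over
`τ` at `r` then gives the identity without sup and inf (`iInf_max_iSup_split`,
`Standing.payoff_split`).

Optimization: for `≤`, the continuation of `δ` after each `a` competes in the value at time `r`. For
`≥`, below any level `m` under the right-hand side, `δ` is followed up to `r` and then a strategy
guaranteeing `m` from the point reached. It is chosen by that point alone, hence non-anticipatively,
and strategies being arbitrary maps, no measurable selection is needed. -/

namespace SoftReachAvoid

/-! ### Carathéodory differential equations: uniqueness and existence -/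

section ODE

open Filter Topology

variable {E : Type*} [NormedAddCommGroup E] [NormedSpace ℝ E]

/-- If the norm of a curve is differentiable, its derivative is at most the speed of the curve. -/
theorem deriv_norm_le_norm_deriv {g : ℝ → E} {g' : E} {u' s : ℝ} (hg : HasDerivAt g g' s)
    (hu : HasDerivAt (fun r => ‖g r‖) u' s) : u' ≤ ‖g'‖ := by
  rw [hasDerivAt_iff_tendsto_slope] at hg hu
  refine le_of_tendsto_of_tendsto hu hg.norm (Eventually.of_forall fun r => ?_)
  rw [slope_def_field]
  simp only [slope_def_module, norm_smul, norm_inv, Real.norm_eq_abs]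
  refine (le_abs_self _).trans ?_
  rw [abs_div, div_eq_inv_mul]
  gcongr
  exact abs_norm_sub_norm_le _ _

theorem absolutelyContinuousOnInterval_norm {E : Type*} [NormedAddCommGroup E] {g : ℝ → E} {a b : ℝ}
    (hg : AbsolutelyContinuousOnInterval g a b) :
    AbsolutelyContinuousOnInterval (fun r => ‖g r‖) a b := by
  refine squeeze_zero (fun _ => Finset.sum_nonneg fun _ _ => dist_nonneg) (fun _ => ?_) hg
  refine Finset.sum_le_sum fun i _ => ?_
  rw [dist_eq_norm, dist_eq_norm]
  exact abs_norm_sub_norm_le _ _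

/-- An absolutely continuous curve that vanishes at the left end point and whose speed is at most
`K` times its norm vanishes identically. -/
theorem eqOn_zero_of_norm_deriv_le {g : ℝ → E} {g' : ℝ → E} {K t s : ℝ} (hts : t ≤ s)
    (hg : AbsolutelyContinuousOnInterval g t s) (h₀ : g t = 0)
    (hd : ∀ᵐ r ∂volume.restrict (Icc t s), HasDerivAt g (g' r) r ∧ ‖g' r‖ ≤ K * ‖g r‖) :
    g s = 0 := by
  -- Grönwall with an integrating factor: `exp (-K r) * ‖g r‖` is absolutely continuous with a.e.
  -- nonpositive derivative, so it cannot rise from its initial value zero.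
  have hexp : AbsolutelyContinuousOnInterval (fun r => Real.exp (-K * r)) t s :=
    ContDiffOn.absolutelyContinuousOnInterval (ContDiff.contDiffOn (by fun_prop))
  have hu := absolutelyContinuousOnInterval_norm hg
  have hint := (hexp.fun_mul hu).integral_deriv_eq_sub
  have hle : ∫ r in t..s, deriv (fun r => Real.exp (-K * r) * ‖g r‖) r ≤ 0 := by
    rw [intervalIntegral.integral_of_le hts, ← integral_Icc_eq_integral_Ioc]
    refine integral_nonpos_of_ae ?_
    have hdu : ∀ᵐ r ∂volume.restrict (Icc t s), DifferentiableAt ℝ (fun r => ‖g r‖) r := by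
      rw [ae_restrict_iff' measurableSet_Icc, ← uIcc_of_le hts]
      exact hu.ae_differentiableAt
    filter_upwards [hd, hdu] with r hr hur
    have h1 : HasDerivAt (fun r => Real.exp (-K * r)) (Real.exp (-K * r) * (-K * 1)) r :=
      ((hasDerivAt_id r).const_mul (-K)).exp
    rw [(h1.fun_mul hur.hasDerivAt).deriv]
    have h2 := (deriv_norm_le_norm_deriv hr.1 hur.hasDerivAt).trans hr.2
    have h3 := mul_le_mul_of_nonneg_left h2 (Real.exp_pos (-K * r)).le
    simp only [Pi.zero_apply]
    linarith
  rw [hint, h₀, norm_zero, mul_zero, sub_zero] at hle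
  have := nonpos_of_mul_nonpos_right hle (Real.exp_pos _)
  simpa using this

/-- Uniqueness of absolutely continuous solutions of a differential equation whose right-hand side
is Lipschitz in the state. -/
theorem eq_of_ae_hasDerivAt {F : ℝ → E → E} {K : ℝ≥0} {t s : ℝ} {y y' : ℝ → E} (hts : t ≤ s)
    (hF : ∀ r ∈ Icc t s, LipschitzWith K (F r))
    (hy : AbsolutelyContinuousOnInterval y t s) (hy' : AbsolutelyContinuousOnInterval y' t s)
    (h₀ : y t = y' t)
    (hd : ∀ᵐ r ∂volume.restrict (Icc t s), HasDerivAt y (F r (y r)) r)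
    (hd' : ∀ᵐ r ∂volume.restrict (Icc t s), HasDerivAt y' (F r (y' r)) r) :
    y s = y' s := by
  rw [← sub_eq_zero]
  refine eqOn_zero_of_norm_deriv_le (g := fun r => y r - y' r)
    (g' := fun r => F r (y r) - F r (y' r)) (K := K) hts (hy.sub hy') (sub_eq_zero.2 h₀) ?_
  filter_upwards [hd, hd', ae_restrict_mem measurableSet_Icc] with r h1 h2 hr
  exact ⟨h1.sub h2, (hF r hr).norm_sub_le _ _⟩

/-- Existence of Lipschitz solutions of a differential equation whose right-hand side is bounded,
Lipschitz in the state and measurable in time. -/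
theorem exists_ae_hasDerivAt [CompleteSpace E] {F : ℝ → E → E} {K M : ℝ≥0} {t T : ℝ} (htT : t ≤ T)
    (hF : ∀ r ∈ Icc t T, LipschitzWith K (F r)) (hM : ∀ r ∈ Icc t T, ∀ y, ‖F r y‖ ≤ M)
    (hmeas : ∀ y : ℝ → E, Continuous y →
      AEStronglyMeasurable (fun r => F r (y r)) (volume.restrict (Icc t T)))
    (y₀ : E) :
    ∃ y : ℝ → E, AbsolutelyContinuousOnInterval y t T ∧ y t = y₀ ∧
      ∀ᵐ r ∂volume.restrict (Icc t T), HasDerivAt y (F r (y r)) r := by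
  have hint : ∀ y : ℝ → E, Continuous y → ∀ a ∈ Icc t T, ∀ b ∈ Icc t T,
      IntervalIntegrable (fun r => F r (y r)) volume a b := by
    intro y hy a ha b hb
    have : IntegrableOn (fun r => F r (y r)) (Icc t T) volume :=
      Integrable.of_bound (hmeas y hy) M
        ((ae_restrict_mem measurableSet_Icc).mono fun r hr => hM r hr _)
    rw [intervalIntegrable_iff]
    exact this.mono_set (uIoc_subset_uIcc.trans (uIcc_subset_Icc ha hb))
  have hlip : ∀ y : ℝ → E, Continuous y →
      LipschitzOnWith M (fun s => y₀ + ∫ r in t..s, F r (y r)) (Icc t T) := by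
    intro y hy
    refine LipschitzOnWith.of_dist_le_mul fun a ha b hb => ?_
    rw [dist_add_left, dist_eq_norm, intervalIntegral.integral_interval_sub_left
      (hint y hy t ⟨le_rfl, htT⟩ a ha) (hint y hy t ⟨le_rfl, htT⟩ b hb), Real.dist_eq]
    exact intervalIntegral.norm_integral_le_of_norm_le_const fun r hr =>
      hM r (uIcc_subset_Icc hb ha (uIoc_subset_uIcc hr)) _
  -- The unknown is `v r = exp (-2 K r) • y r`, and `e` recovers `y`. With this weight the Picard
  -- map contracts by `1 / 2` in the sup norm on the whole interval, however long.
  let e : C(Icc t T, E) → ℝ → E := fun v r => Real.exp (2 * K * r) • v (projIcc t T htT r)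
  have he : ∀ v, Continuous (e v) := fun v =>
    (by fun_prop : Continuous fun r : ℝ => Real.exp (2 * K * r)).smul
      (v.continuous.comp continuous_projIcc)
  let Φ : C(Icc t T, E) → C(Icc t T, E) := fun v =>
    ⟨fun s => Real.exp (-(2 * K * s)) • (y₀ + ∫ r in t..s, F r (e v r)),
      (by fun_prop : Continuous fun s : Icc t T => Real.exp (-(2 * K * s.1))).smul
        (continuousOn_iff_continuous_domRestrict.1 (hlip _ (he v)).continuousOn)⟩
  have hΦ : ContractingWith (1 / 2) Φ := by
    refine ⟨by norm_num [← NNReal.coe_lt_coe], LipschitzWith.of_dist_le_mul fun v w => ?_⟩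
    rw [ContinuousMap.dist_le (by positivity)]
    intro s
    have hs := s.2
    have htt : t ∈ Icc t T := ⟨le_rfl, htT⟩
    simp only [Φ, ContinuousMap.coe_mk]
    rw [dist_smul₀, dist_add_left, dist_eq_norm,
      ← intervalIntegral.integral_sub (hint _ (he v) t htt s hs) (hint _ (he w) t htt s hs)]
    have hexpint : ∫ r in t..s, (2 * K) * Real.exp (2 * K * r) * (dist v w / 2) =
        (Real.exp (2 * K * s) - Real.exp (2 * K * t)) * (dist v w / 2) := by
      rw [intervalIntegral.integral_mul_const]
      congr 1
      refine intervalIntegral.integral_eq_sub_of_hasDerivAt (f := fun r => Real.exp (2 * K * r))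
        (fun r _ => ?_) ((by fun_prop : Continuous _).intervalIntegrable _ _)
      simpa [mul_comm] using ((hasDerivAt_id r).const_mul (2 * (K : ℝ))).exp
    have hb : ‖∫ r in t..s, (F r (e v r) - F r (e w r))‖ ≤
        ∫ r in t..s, (2 * K) * Real.exp (2 * K * r) * (dist v w / 2) := by
      refine intervalIntegral.norm_integral_le_of_norm_le hs.1 (Eventually.of_forall fun r hr => ?_)
        ((by fun_prop : Continuous _).intervalIntegrable _ _)
      have hr' : r ∈ Icc t T := ⟨hr.1.le, hr.2.trans hs.2⟩
      refine ((hF r hr').norm_sub_le _ _).trans ?_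
      rw [← smul_sub, norm_smul, Real.norm_of_nonneg (Real.exp_pos _).le, ← dist_eq_norm]
      have := ContinuousMap.dist_apply_le_dist (f := v) (g := w) (projIcc t T htT r)
      calc (K : ℝ) * (Real.exp (2 * K * r) * _) ≤ K * (Real.exp (2 * K * r) * dist v w) := by
            gcongr
        _ = _ := by ring
    rw [Real.norm_of_nonneg (Real.exp_pos _).le]
    calc Real.exp (-(2 * K * s)) * _
        ≤ Real.exp (-(2 * K * s)) * (Real.exp (2 * K * s) * (dist v w / 2)) := by
          gcongr
          refine hb.trans (hexpint.le.trans ?_)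
          gcongr
          linarith [Real.exp_pos (2 * K * t)]
      _ = ((1 / 2 : ℝ≥0) : ℝ) * dist v w := by
          rw [← mul_assoc, ← Real.exp_add]; simp; ring
  have : Nonempty (Icc t T) := ⟨⟨t, le_rfl, htT⟩⟩
  set v := ContractingWith.fixedPoint Φ hΦ
  have hv : Φ v = v := hΦ.fixedPoint_isFixedPt
  have hev : ∀ s ∈ Icc t T, e v s = y₀ + ∫ r in t..s, F r (e v r) := by
    intro s hs
    have : v ⟨s, hs⟩ = Real.exp (-(2 * K * s)) • (y₀ + ∫ r in t..s, F r (e v r)) := by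
      conv_lhs => rw [← hv]
      rfl
    simp only [e, projIcc_of_mem htT hs]
    rw [this, smul_smul, ← Real.exp_add]
    simp [e]
  refine ⟨fun s => y₀ + ∫ r in t..s, F r (e v r), ?_, by simp, ?_⟩
  · refine LipschitzOnWith.absolutelyContinuousOnInterval (K := M) ?_
    rw [uIcc_of_le htT]
    exact hlip _ (he v)
  · have hd := (hint _ (he v) t ⟨le_rfl, htT⟩ T ⟨htT, le_rfl⟩).ae_hasDerivAt_integral
    rw [ae_restrict_iff' measurableSet_Icc]
    filter_upwards [hd] with s hs hsT
    rw [← hev s hsT]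
    exact (hs (by rwa [uIcc_of_le htT]) t left_mem_uIcc).const_add y₀

end ODE

end SoftReachAvoid

noncomputable section

namespace SoftReachAvoid

/-! ### Almost everywhere agreement and gluing of controls -/

section Agree

variable {m : ℕ} {t r s : ℝ} {u v w : ℝ → Vec m}

theorem AgreeOn.rfl : AgreeOn t s u u := Filter.EventuallyEq.rfl

theorem AgreeOn.symm (h : AgreeOn t s u v) : AgreeOn t s v u := Filter.EventuallyEq.symm h

theorem AgreeOn.trans (h : AgreeOn t s u v) (h' : AgreeOn t s v w) : AgreeOn t s u w :=
  Filter.EventuallyEq.trans h h'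

theorem AgreeOn.mono {t' s' : ℝ} (h : AgreeOn t s u v) (ht : t ≤ t') (hs : s' ≤ s) :
    AgreeOn t' s' u v :=
  ae_restrict_of_ae_restrict_of_subset (Icc_subset_Icc ht hs) h

theorem AgreeOn.union (h : AgreeOn t r u v) (h' : AgreeOn r s u v) : AgreeOn t s u v :=
  ae_restrict_of_ae_restrict_of_subset Icc_subset_Icc_union_Icc
    ((ae_restrict_union_iff _ _ _).2 ⟨h, h'⟩)

end Agree

/-- The projection of a subtype, for an abstract predicate. Stated separately because the kernel is
slow when it compares controls on different intervals. -/
theorem subtype_mk_val {α : Type*} {P : α → Prop} (x : α) (hx : P x) :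
    (⟨x, hx⟩ : {x // P x}).1 = x :=
  rfl

namespace Controls

variable {m : ℕ} {t r s T : ℝ} {U : Set (Vec m)}

/-- The constant control. -/
def const {c : Vec m} (hc : c ∈ U) : Controls t T U :=
  ⟨fun _ => c, aemeasurable_const, fun _ _ => hc⟩

/-- A control on `[t, T]`, seen as a control on `[r, T]`. -/
def restrict (h : t ≤ r) (u : Controls t T U) : Controls r T U :=
  ⟨u.1, u.2.1.mono_set (Icc_subset_Icc_left h), fun s hs => u.2.2 s ⟨h.trans hs.1, hs.2⟩⟩

theorem restrict_val (h : t ≤ r) (u : Controls t T U) : (restrict h u).1 = u.1 :=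
  subtype_mk_val u.1 _

theorem restrict_agreeOn (h : t ≤ r) (u : Controls t T U) : AgreeOn r s (restrict h u).1 u.1 := by
  rw [restrict_val]
  exact AgreeOn.rfl

/-- The control that is `u` up to time `r` and `v` afterwards. -/
def glue (_ : t ≤ r) (u : Controls t T U) (v : Controls r T U) : Controls t T U :=
  ⟨fun s => if s ≤ r then u.1 s else v.1 s, by
    refine ⟨fun s => if s ≤ r then u.2.1.mk u.1 s else v.2.1.mk v.1 s,
      Measurable.ite measurableSet_Iic u.2.1.measurable_mk v.2.1.measurable_mk, ?_⟩
    -- The measurable version of `v` is controlled only on `[r, T]`; as an implication, the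
    -- statement carries over to `[t, T]`.
    have hv := (ae_restrict_iff' measurableSet_Icc).1 v.2.1.ae_eq_mk
    filter_upwards [u.2.1.ae_eq_mk, ae_restrict_of_ae hv, ae_restrict_mem measurableSet_Icc]
      with s h1 h2 hs
    split_ifs with hsr
    · exact h1
    · exact h2 ⟨(not_le.1 hsr).le, hs.2⟩, fun s hs => by
    show (if s ≤ r then u.1 s else v.1 s) ∈ U
    split_ifs with hsr
    · exact u.2.2 s hs
    · exact v.2.2 s ⟨(not_le.1 hsr).le, hs.2⟩⟩

theorem glue_agreeOn_left (h : t ≤ r) (u : Controls t T U) (v : Controls r T U) (hs : s ≤ r) :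
    AgreeOn t s (glue h u v).1 u.1 := by
  filter_upwards [ae_restrict_mem measurableSet_Icc] with τ hτ
  exact if_pos (hτ.2.trans hs)

theorem glue_agreeOn_right (h : t ≤ r) (u : Controls t T U) (v : Controls r T U) :
    AgreeOn r s (glue h u v).1 v.1 := by
  -- At `r` itself the glued control takes the value of `u`, which is harmless because a point is
  -- null.
  have hne : ∀ᵐ τ ∂volume.restrict (Icc r s), τ ≠ r :=
    ae_restrict_of_ae (Measure.ae_ne volume r)
  filter_upwards [ae_restrict_mem measurableSet_Icc, hne] with τ hτ hτr
  exact if_neg (not_le.2 (lt_of_le_of_ne hτ.1 hτr.symm))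

/-- Glued controls agree as long as their parts do. -/
theorem glue_agreeOn (htr : t ≤ r)
    {u u' : Controls t T U} {v v' : Controls r T U}
    (hu : ∀ σ ≤ s, σ ≤ r → t ≤ σ → AgreeOn t σ u.1 u'.1) (ht : t ≤ s)
    (hv : r ≤ s → AgreeOn r s v.1 v'.1) :
    AgreeOn t s (glue htr u v).1 (glue htr u' v').1 := by
  have hleft : ∀ σ ≤ s, σ ≤ r → t ≤ σ →
      AgreeOn t σ (glue htr u v).1 (glue htr u' v').1 := fun σ hσs hσr htσ =>
    ((glue_agreeOn_left htr _ _ hσr).trans (hu σ hσs hσr htσ)).trans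
      (glue_agreeOn_left htr _ _ hσr).symm
  rcases le_total s r with hsr | hrs
  · exact hleft s le_rfl hsr ht
  · exact (hleft r hrs le_rfl htr).union (((glue_agreeOn_right htr _ _).trans
      (hv hrs)).trans (glue_agreeOn_right htr _ _).symm)

end Controls

namespace Game

variable {n p q : ℕ} {G : Game n p q} {ε t r s : ℝ}

/-! ### Gluing and continuing non-anticipative strategies -/

section Strategies

/-- Strategies exist because `B` is nonempty. -/
theorem Standing.strategies_nonempty (hG : G.Standing) (t : ℝ) : Nonempty (G.Strategies t) :=
  hG.B_nonempty.elim fun _ hb => ⟨⟨fun _ => Controls.const hb, fun _ _ _ _ _ => AgreeOn.rfl⟩⟩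

/-- The strategy that follows `δ` up to time `r` and from then on the strategy `D a`, which may
depend on the control `a` of the opponent up to time `r`. -/
def Strategies.glue (htr : t ≤ r) (δ : G.Strategies t) (D : G.ControlsA t → G.Strategies r)
    (hD : ∀ a a' : G.ControlsA t, AgreeOn t r a.1 a'.1 → D a = D a') : G.Strategies t :=
  ⟨fun a => Controls.glue htr (δ.1 a) ((D a).1 (Controls.restrict htr a)), by
    intro s hs a a' h
    refine Controls.glue_agreeOn htr (fun σ hσs hσr htσ => ?_) hs.1 (fun hrs => ?_)
    · exact δ.2 σ ⟨htσ, hσs.trans hs.2⟩ a a' (h.mono le_rfl hσs)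
    -- Agreement up to `s ≥ r` includes agreement up to `r`, so both controls face the same second
    -- strategy.
    · rw [hD a a' (h.mono le_rfl hrs)]
      have h' : AgreeOn r s (Controls.restrict htr a).1 (Controls.restrict htr a').1 :=
        ((Controls.restrict_agreeOn htr a).trans (h.mono htr le_rfl)).trans
          (Controls.restrict_agreeOn htr a').symm
      exact (D a').2 s ⟨hrs, hs.2⟩ _ _ h'⟩

/-- The strategy `δ` from time `r` on, when the opponent has played `a` up to time `r`. -/
def Strategies.continuation (htr : t ≤ r) (δ : G.Strategies t) (a : G.ControlsA t) :
    G.Strategies r :=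
  ⟨fun a₂ => Controls.restrict htr (δ.1 (Controls.glue htr a a₂)), by
    intro s hs a₂ a₂' h
    have h' : AgreeOn t s (Controls.glue htr a a₂).1 (Controls.glue htr a a₂').1 :=
      Controls.glue_agreeOn htr (fun _ _ _ _ => AgreeOn.rfl) (htr.trans hs.1) (fun _ => h)
    exact ((Controls.restrict_agreeOn htr _).trans
      (AgreeOn.mono (δ.2 s ⟨htr.trans hs.1, hs.2⟩ _ _ h') htr le_rfl)).trans
      (Controls.restrict_agreeOn htr _).symm⟩

theorem Strategies.glue_apply (htr : t ≤ r) (δ : G.Strategies t)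
    (D : G.ControlsA t → G.Strategies r)
    (hD : ∀ a a' : G.ControlsA t, AgreeOn t r a.1 a'.1 → D a = D a') (a : G.ControlsA t) :
    (δ.glue htr D hD).1 a = Controls.glue htr (δ.1 a) ((D a).1 (Controls.restrict htr a)) :=
  congrFun (subtype_mk_val
    (fun a => Controls.glue htr (δ.1 a) ((D a).1 (Controls.restrict htr a))) _) a

theorem Strategies.continuation_apply (htr : t ≤ r) (δ : G.Strategies t) (a : G.ControlsA t)
    (a₂ : G.ControlsA r) :
    (δ.continuation htr a).1 a₂ = Controls.restrict htr (δ.1 (Controls.glue htr a a₂)) :=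
  congrFun (subtype_mk_val
    (fun a₂ => Controls.restrict htr (δ.1 (Controls.glue htr a a₂))) _) a₂

end Strategies

/-! ### Well-posedness and flow property of the augmented system -/

section Trajectories

theorem Standing.lipschitz_augF (hG : G.Standing) (ε : ℝ) :
    ∃ K : ℝ≥0, ∀ s ∈ Icc 0 G.T, ∀ a ∈ G.A, ∀ b ∈ G.B,
      LipschitzWith K (fun y => G.augF ε s y a b) := by
  obtain ⟨L, hL⟩ := hG.f_lipschitz
  obtain ⟨L₂, hL₂⟩ := hG.c₂_lipschitz
  refine ⟨max (L * 1) (‖1 / ε‖₊ * (L₂ * 1)), fun s hs a ha b hb => ?_⟩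
  refine ((hL s hs a ha b hb).comp LipschitzWith.prod_fst).prodMk ?_
  have hc : LipschitzWith (L₂ * 1) fun y : Vec n × ℝ => G.c₂ s y.1 := by
    refine LipschitzWith.comp (g := fun y : Vec n × ℝ => y.1) (f := G.c₂ s) ?_
      LipschitzWith.prod_fst
    refine LipschitzWith.of_dist_le_mul fun x x' => ?_
    simpa [Prod.dist_eq] using
      hL₂.dist_le_mul (s, x) ⟨hs, mem_univ _⟩ (s, x') ⟨hs, mem_univ _⟩
  exact (((lipschitzWith_smul (1 / ε)).comp hc).const_max 0 |>.const_min 1).neg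

theorem Standing.bounded_augF (hG : G.Standing) (ε : ℝ) :
    ∃ M : ℝ≥0, ∀ s ∈ Icc 0 G.T, ∀ a ∈ G.A, ∀ b ∈ G.B, ∀ y, ‖G.augF ε s y a b‖ ≤ M := by
  obtain ⟨M, hM⟩ := hG.f_bounded
  refine ⟨max M.toNNReal 1, fun s hs a ha b hb y => ?_⟩
  rw [augF, Prod.norm_mk, NNReal.coe_max]
  refine max_le_max ((hM s hs _ a ha b hb).trans (Real.le_coe_toNNReal M)) ?_
  rw [norm_neg, h, Real.norm_of_nonneg (le_min zero_le_one (le_max_left _ _))]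
  exact min_le_left _ _

theorem Standing.aestronglyMeasurable_augF (hG : G.Standing) (ht : 0 ≤ t) (a : G.ControlsA t)
    (b : G.ControlsB t) {y : ℝ → Vec n × ℝ} (hy : Continuous y) :
    AEStronglyMeasurable (fun s => G.augF ε s (y s) (a.1 s) (b.1 s))
      (volume.restrict (Icc t G.T)) := by
  have hsub : Icc t G.T ⊆ Icc 0 G.T := Icc_subset_Icc_left ht
  have hfst : AEMeasurable (fun s => G.f s (y s).1 (a.1 s) (b.1 s))
      (volume.restrict (Icc t G.T)) := by
    classical
    -- Extending `f` by zero off its domain `S` gives a Borel function, which can be composed with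
    -- merely a.e. measurable controls.
    set S : Set (ℝ × Vec n × Vec p × Vec q) := Icc 0 G.T ×ˢ univ ×ˢ G.A ×ˢ G.B
    have hS : MeasurableSet S := measurableSet_Icc.prod
      (MeasurableSet.univ.prod (hG.A_compact.measurableSet.prod hG.B_compact.measurableSet))
    have hm := hG.f_uniformContinuous.continuousOn.measurable_piecewise
      (continuousOn_const (c := (0 : Vec n))) hS
    have hc : AEMeasurable (fun s => (s, (y s).1, a.1 s, b.1 s)) (volume.restrict (Icc t G.T)) :=
      aemeasurable_id.prodMk (hy.fst.measurable.aemeasurable.prodMk (a.2.1.prodMk b.2.1))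
    refine (hm.comp_aemeasurable hc).congr ?_
    filter_upwards [ae_restrict_mem measurableSet_Icc] with s hs
    exact piecewise_eq_of_mem _ _ _ ⟨hsub hs, mem_univ _, a.2.2 s hs, b.2.2 s hs⟩
  have hsnd : ContinuousOn (fun s => -G.h ε s (y s).1) (Icc t G.T) := by
    obtain ⟨L₂, hL₂⟩ := hG.c₂_lipschitz
    have hc : ContinuousOn (fun s => G.c₂ s (y s).1) (Icc t G.T) :=
      hL₂.continuousOn.comp (f := fun s => (s, (y s).1))
        (continuous_id.prodMk hy.fst).continuousOn fun s hs => ⟨hsub hs, mem_univ _⟩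
    exact (continuousOn_const.inf (continuousOn_const.sup (continuousOn_const.mul hc))).neg
  exact hfst.aestronglyMeasurable.prodMk (hsnd.aestronglyMeasurable measurableSet_Icc)

/-- A trajectory exists for all controls. -/
theorem Standing.isTrajectory_traj (hG : G.Standing) (ht : t ∈ Icc 0 G.T) (x : Vec n) (z : ℝ)
    (a : G.ControlsA t) (b : G.ControlsB t) :
    G.IsTrajectory ε t x z a.1 b.1 (G.traj ε t x z a.1 b.1) := by
  obtain ⟨K, hK⟩ := hG.lipschitz_augF ε
  obtain ⟨M, hM⟩ := hG.bounded_augF ε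
  have hsub : Icc t G.T ⊆ Icc 0 G.T := Icc_subset_Icc_left ht.1
  exact Classical.epsilon_spec (exists_ae_hasDerivAt
    (F := fun s y => G.augF ε s y (a.1 s) (b.1 s)) ht.2
    (fun s hs => hK s (hsub hs) _ (a.2.2 s hs) _ (b.2.2 s hs))
    (fun s hs => hM s (hsub hs) _ (a.2.2 s hs) _ (b.2.2 s hs))
    (fun y hy => hG.aestronglyMeasurable_augF ht.1 a b hy) (x, z))

/-- A trajectory from time `t` and a trajectory from a later time `r` that meet at time `r`
coincide as long as the controls do. -/
theorem IsTrajectory.eqOn (hG : G.Standing) (ht : 0 ≤ t) (htr : t ≤ r) (hs : s ≤ G.T)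
    {x x' : Vec n} {z z' : ℝ} {a : G.ControlsA t} {b : G.ControlsB t} {a' : ℝ → Vec p}
    {b' : ℝ → Vec q} {y y' : ℝ → Vec n × ℝ} (hy : G.IsTrajectory ε t x z a.1 b.1 y)
    (hy' : G.IsTrajectory ε r x' z' a' b' y') (ha : AgreeOn r s a.1 a') (hb : AgreeOn r s b.1 b')
    (hr : y r = (x', z')) : EqOn y y' (Icc r s) := by
  intro τ hτ
  obtain ⟨K, hK⟩ := hG.lipschitz_augF ε
  have hτT : τ ≤ G.T := hτ.2.trans hs
  have hrT : r ≤ G.T := hτ.1.trans hτT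
  refine eq_of_ae_hasDerivAt (F := fun s y => G.augF ε s y (a.1 s) (b.1 s)) (K := K) hτ.1
    (fun σ hσ => ?_) (hy.1.mono ?_) (hy'.1.mono ?_) (hr.trans hy'.2.1.symm)
    (ae_restrict_of_ae_restrict_of_subset (Icc_subset_Icc htr hτT) hy.2.2) ?_
  · have hσ' : σ ∈ Icc t G.T := ⟨htr.trans hσ.1, hσ.2.trans hτT⟩
    exact hK σ ⟨ht.trans hσ'.1, hσ'.2⟩ _ (a.2.2 σ hσ') _ (b.2.2 σ hσ')
  · rw [uIcc_of_le hτ.1, uIcc_of_le (htr.trans hrT)]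
    exact Icc_subset_Icc htr hτT
  · rw [uIcc_of_le hτ.1, uIcc_of_le hrT]
    exact Icc_subset_Icc le_rfl hτT
  · filter_upwards [ha.mono le_rfl hτ.2, hb.mono le_rfl hτ.2,
      ae_restrict_of_ae_restrict_of_subset (Icc_subset_Icc le_rfl hτT) hy'.2.2] with σ h1 h2 h3
    rwa [h1, h2]

theorem Standing.traj_eqOn (hG : G.Standing) (ht : t ∈ Icc 0 G.T) (hs : s ≤ G.T) (x : Vec n)
    (z : ℝ) {a a' : G.ControlsA t} {b b' : G.ControlsB t} (ha : AgreeOn t s a.1 a'.1)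
    (hb : AgreeOn t s b.1 b'.1) :
    EqOn (G.traj ε t x z a.1 b.1) (G.traj ε t x z a'.1 b'.1) (Icc t s) :=
  (hG.isTrajectory_traj ht x z a b).eqOn hG ht.1 le_rfl hs (hG.isTrajectory_traj ht x z a' b') ha hb
    (hG.isTrajectory_traj ht x z a b).2.1

end Trajectories

/-! ### Splitting the payoff at an intermediate time -/

section Payoff

/-- A running maximum within a minimum, split at an intermediate time. -/
theorem iInf_max_iSup_split {α : Type*} [CompleteLinearOrder α] (c k : ℝ → α) {T : ℝ}
    (htr : t ≤ r) (hrT : r ≤ T) :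
    ⨅ τ ∈ Icc t T, max (⨆ s ∈ Icc t τ, c s) (k τ) =
      min (⨅ τ ∈ Icc t r, max (⨆ s ∈ Icc t τ, c s) (k τ))
        (max (⨆ s ∈ Icc t r, c s) (⨅ τ ∈ Icc r T, max (⨆ s ∈ Icc r τ, c s) (k τ))) := by
  rw [← Icc_union_Icc_eq_Icc htr hrT, iInf_union]
  refine congrArg _ ?_
  -- For `τ ≥ r` the maximum over `[t, r]` does not depend on `τ`, and max with a constant
  -- distributes over infima.
  rw [sup_iInf₂_eq]
  refine iInf_congr fun τ => iInf_congr fun hτ => ?_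
  rw [← Icc_union_Icc_eq_Icc htr hτ.1, iSup_union, sup_assoc]

/-- The reach-avoid payoff of a curve within `[t, r]`. -/
def payoffAlong (G : Game n p q) (t r : ℝ) (y : ℝ → Vec n × ℝ) : EReal :=
  ⨅ τ ∈ Icc t r, max (⨆ s ∈ Icc t τ, (G.c₁ s (y s).1 : EReal))
    (max (G.c₂ τ (y τ).1 : EReal) (max ((-(y τ).2 : ℝ) : EReal) (G.g τ (y τ).1 : EReal)))

theorem payoff_eq_payoffAlong (x : Vec n) (z : ℝ) (a : ℝ → Vec p) (b : ℝ → Vec q) :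
    G.payoff ε t x z a b r = G.payoffAlong t r (G.traj ε t x z a b) := rfl

theorem iSup_c₁_congr {y y' : ℝ → Vec n × ℝ} (h : EqOn y y' (Icc t r)) :
    ⨆ s ∈ Icc t r, (G.c₁ s (y s).1 : EReal) = ⨆ s ∈ Icc t r, (G.c₁ s (y' s).1 : EReal) :=
  iSup_congr fun s => iSup_congr fun hs => by rw [h hs]

theorem payoffAlong_congr {y y' : ℝ → Vec n × ℝ} (h : EqOn y y' (Icc t r)) :
    G.payoffAlong t r y = G.payoffAlong t r y' :=
  iInf_congr fun τ => iInf_congr fun hτ => by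
    rw [iSup_c₁_congr (h.mono (Icc_subset_Icc_right hτ.2)), h hτ]

/-- The payoff within `[t, T]` in terms of the trajectory on `[t, r]` and the payoff within
`[r, T]` from its end point. Controls only matter up to almost everywhere equality. -/
theorem Standing.payoff_split (hG : G.Standing) (ht : 0 ≤ t) (htr : t ≤ r) (hrT : r ≤ G.T)
    (x : Vec n) (z : ℝ) {a a₁ : G.ControlsA t} {b b₁ : G.ControlsB t} {a₂ : G.ControlsA r}
    {b₂ : G.ControlsB r} (ha₁ : AgreeOn t r a.1 a₁.1) (hb₁ : AgreeOn t r b.1 b₁.1)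
    (ha₂ : AgreeOn r G.T a.1 a₂.1) (hb₂ : AgreeOn r G.T b.1 b₂.1) :
    G.payoff ε t x z a.1 b.1 G.T =
      min (G.payoff ε t x z a₁.1 b₁.1 r)
        (max (G.runningC₁ ε t x z a₁.1 b₁.1 r)
          (G.payoff ε r (G.φ ε t x z a₁.1 b₁.1 r) (G.ξ ε t x z a₁.1 b₁.1 r) a₂.1 b₂.1 G.T)) := by
  have htT : t ∈ Icc 0 G.T := ⟨ht, htr.trans hrT⟩
  have h1 : EqOn (G.traj ε t x z a.1 b.1) (G.traj ε t x z a₁.1 b₁.1) (Icc t r) :=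
    hG.traj_eqOn htT hrT x z ha₁ hb₁
  have h2 := (hG.isTrajectory_traj (ε := ε) htT x z a b).eqOn hG ht htr le_rfl
    (hG.isTrajectory_traj (ε := ε) ⟨ht.trans htr, hrT⟩ (G.φ ε t x z a₁.1 b₁.1 r)
      (G.ξ ε t x z a₁.1 b₁.1 r) a₂ b₂) ha₂ hb₂ (h1 ⟨htr, le_rfl⟩)
  simp only [payoff_eq_payoffAlong]
  rw [← payoffAlong_congr h1, ← payoffAlong_congr h2]
  have h3 : G.runningC₁ ε t x z a₁.1 b₁.1 r =
      ⨆ s ∈ Icc t r, (G.c₁ s (G.traj ε t x z a.1 b.1 s).1 : EReal) := (iSup_c₁_congr h1).symm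
  rw [h3]
  exact iInf_max_iSup_split _ _ htr hrT

end Payoff

/-! ### Finiteness of the value and the two inequalities -/

section Value

/-- Every running maximum includes the time `t`, which bounds all payoffs below by `c₁ t x`;
stopping at `τ = t` bounds them above by initial data. -/
theorem Standing.W_real (hG : G.Standing) (ht : t ∈ Icc 0 G.T) (x : Vec n) (z : ℝ) :
    ∃ w : ℝ, G.W ε t x z = (w : EReal) := by
  have hstart : ∀ (a : G.ControlsA t) (b : G.ControlsB t), G.traj ε t x z a.1 b.1 t = (x, z) :=
    fun a b => (hG.isTrajectory_traj ht x z a b).2.1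
  have htt : t ∈ Icc t G.T := ⟨le_rfl, ht.2⟩
  have hlow : (G.c₁ t x : EReal) ≤ G.W ε t x z := by
    obtain ⟨δ⟩ := hG.strategies_nonempty t
    refine le_iSup_of_le δ (le_iInf fun a => le_iInf₂ fun τ hτ => le_max_of_le_left ?_)
    refine le_iSup₂_of_le t ⟨le_rfl, hτ.1⟩ ?_
    rw [φ, hstart]
  have hup : G.W ε t x z ≤ ((max (G.c₁ t x) (max (G.c₂ t x) (max (-z) (G.g t x))) : ℝ) : EReal) := by
    obtain ⟨a₀, ha₀⟩ := hG.A_nonempty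
    refine iSup_le fun δ => iInf_le_of_le (Controls.const ha₀) (iInf₂_le_of_le t htt ?_)
    simp only [runningC₁, φ, ξ, Icc_self, mem_singleton_iff, iSup_iSup_eq_left, hstart]
    simp only [EReal.coe_strictMono.monotone.map_max, le_refl]
  refine ⟨(G.W ε t x z).toReal, (EReal.coe_toReal ?_ ?_).symm⟩
  · exact (hup.trans_lt (EReal.coe_lt_top _)).ne
  · exact ((EReal.bot_lt_coe _).trans_le hlow).ne'

/-- The same `δ` serves on both sides: against `a` followed by any `a₂`, it answers up to `r` as
against `a`, and afterwards as its continuation. -/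
theorem Standing.W_le (hG : G.Standing) (ht : 0 ≤ t) (htr : t ≤ r) (hrT : r ≤ G.T)
    (x : Vec n) (z : ℝ) :
    G.W ε t x z ≤ ⨆ δ : G.Strategies t, ⨅ a : G.ControlsA t,
      min (G.payoff ε t x z a.1 (δ.1 a).1 r)
        (max (G.runningC₁ ε t x z a.1 (δ.1 a).1 r)
          (G.W ε r (G.φ ε t x z a.1 (δ.1 a).1 r) (G.ξ ε t x z a.1 (δ.1 a).1 r))) := by
  refine iSup_le fun δ => le_iSup_of_le δ (le_iInf fun a => ?_)
  set m := ⨅ a : G.ControlsA t, G.payoff ε t x z a.1 (δ.1 a).1 G.T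
  have key : ∀ a₂ : G.ControlsA r, m ≤ min (G.payoff ε t x z a.1 (δ.1 a).1 r)
      (max (G.runningC₁ ε t x z a.1 (δ.1 a).1 r)
        (G.payoff ε r (G.φ ε t x z a.1 (δ.1 a).1 r) (G.ξ ε t x z a.1 (δ.1 a).1 r) a₂.1
          ((δ.continuation htr a).1 a₂).1 G.T)) := by
    intro a₂
    rw [Strategies.continuation_apply]
    have hag := Controls.glue_agreeOn_left htr a a₂ le_rfl
    rw [← hG.payoff_split ht htr hrT x z (a := Controls.glue htr a a₂) (b := δ.1 (Controls.glue htr a a₂)) hag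
      (δ.2 r ⟨htr, hrT⟩ _ _ hag) (Controls.glue_agreeOn_right htr _ _)
      (Controls.restrict_agreeOn htr _).symm]
    exact iInf_le _ _
  refine le_min ((key (Controls.restrict htr a)).trans (min_le_left _ _)) (le_max_iff.2 ?_)
  -- The running maximum is independent of `a₂`: if it is below `m`, every continued payoff must
  -- reach `m`.
  refine or_iff_not_imp_left.2 fun hm => le_iSup_of_le (δ.continuation htr a) (le_iInf fun a₂ => ?_)
  exact (le_max_iff.1 ((key a₂).trans (min_le_right _ _))).resolve_left hm

theorem Standing.le_W (hG : G.Standing) (ht : 0 ≤ t) (htr : t ≤ r) (hrT : r ≤ G.T)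
    (x : Vec n) (z : ℝ) :
    ⨆ δ : G.Strategies t, ⨅ a : G.ControlsA t,
      min (G.payoff ε t x z a.1 (δ.1 a).1 r)
        (max (G.runningC₁ ε t x z a.1 (δ.1 a).1 r)
          (G.W ε r (G.φ ε t x z a.1 (δ.1 a).1 r) (G.ξ ε t x z a.1 (δ.1 a).1 r))) ≤
      G.W ε t x z := by
  refine iSup_le fun δ => le_of_forall_lt_imp_le_of_dense fun m hm => ?_
  -- A strict level `m` replaces near-optimality. Where the value does not exceed `m`, any strategy
  -- will do: there the running maximum alone must exceed `m`.
  have hopt : ∀ y : Vec n × ℝ, ∃ δ' : G.Strategies r, m < G.W ε r y.1 y.2 →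
      m ≤ ⨅ a : G.ControlsA r, G.payoff ε r y.1 y.2 a.1 (δ'.1 a).1 G.T := by
    intro y
    by_cases h : m < G.W ε r y.1 y.2
    · obtain ⟨δ', h'⟩ := lt_iSup_iff.1 h
      exact ⟨δ', fun _ => h'.le⟩
    · exact ⟨(hG.strategies_nonempty r).some, fun h' => absurd h' h⟩
  choose D hD using hopt
  have hDa : ∀ a a' : G.ControlsA t, AgreeOn t r a.1 a'.1 →
      D (G.traj ε t x z a.1 (δ.1 a).1 r) = D (G.traj ε t x z a'.1 (δ.1 a').1 r) := fun a a' h => by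
    rw [hG.traj_eqOn ⟨ht, htr.trans hrT⟩ hrT x z h (δ.2 r ⟨htr, hrT⟩ a a' h) ⟨htr, le_rfl⟩]
  refine le_iSup_of_le (δ.glue htr (fun a => D (G.traj ε t x z a.1 (δ.1 a).1 r)) hDa)
    (le_iInf fun a => ?_)
  rw [Strategies.glue_apply]
  refine le_of_le_of_eq ?_ (hG.payoff_split ht htr hrT x z (a₁ := a) (b₁ := δ.1 a)
    (a₂ := Controls.restrict htr a) AgreeOn.rfl (Controls.glue_agreeOn_left htr _ _ le_rfl)
    (Controls.restrict_agreeOn htr a).symm (Controls.glue_agreeOn_right htr _ _)).symm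
  obtain ⟨h1, h2⟩ := lt_min_iff.1 (hm.trans_le (iInf_le _ a))
  refine le_min h1.le (le_max_iff.2 ((lt_max_iff.1 h2).imp le_of_lt fun h => ?_))
  exact (hD (G.traj ε t x z a.1 (δ.1 a).1 r) h).trans (iInf_le _ (Controls.restrict htr a))

end Value

end Game

end SoftReachAvoid

end

theorem proposition8 {n p q : ℕ} (G : SoftReachAvoid.Game n p q) (hG : G.Standing)
    (ε : ℝ) (hε : 0 < ε) :
    -- the value function is real-valued
    (∀ t ∈ Set.Icc 0 G.T, ∀ (x : SoftReachAvoid.Vec n) (z : ℝ), ∃ w : ℝ, G.W ε t x z = (w : EReal)) ∧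
    -- the dynamic programming principle
    ∀ t ∈ Set.Ico 0 G.T, ∀ d : ℝ, 0 < d → t + d ≤ G.T →
      ∀ (x : SoftReachAvoid.Vec n) (z : ℝ),
        G.W ε t x z =
          ⨆ δ : G.Strategies t, ⨅ a : G.ControlsA t,
            min
              (G.payoff ε t x z a.1 (δ.1 a).1 (t + d))
              (max
                (G.runningC₁ ε t x z a.1 (δ.1 a).1 (t + d))
                (G.W ε (t + d)
                  (G.φ ε t x z a.1 (δ.1 a).1 (t + d))
                  (G.ξ ε t x z a.1 (δ.1 a).1 (t + d)))) := by
  refine ⟨fun t ht x z => hG.W_real ht x z, fun t ht d hd hdT x z => ?_⟩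
  have htd : t ≤ t + d := by linarith
  exact le_antisymm (hG.W_le ht.1 htd hdT x z) (hG.le_W ht.1 htd hdT x z)
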